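/- For a positive integer $m$ let $\mathcal P_m$ be the family of all sets of $m$ points in the Euclidean plane in which the distance between any two points is at most $1$. For $0<r\le 1$ let $N_m(r)$ be the largest integer $k$ such that for every $P\in\mathcal P_m$ there is a closed circular disc of radius $r$ which covers at least $k$ points of $P$. Then for every positive integer $n$, $$n\;\le\; N_{3n}\!\left(\tfrac12\right)\;\le\; n+1 .$$ The same bounds hold if the $m$ points are allowed to coincide and are counted with multiplicity in the definitions of $\mathcal P_m$ and $N_m(r)$. -/

import Mathlib

namespace DartBoard

/-- The Euclidean plane. -/
abbrev Plane : Type := EuclideanSpace ℝ (Fin 2)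

/-- The family `𝒫_n` of all sets of `n` (distinct) points of the plane in which the distance
between any two points is at most `1`. -/
def pointSets (n : ℕ) : Set (Finset Plane) :=
  {P | P.card = n ∧ ∀ x ∈ P, ∀ y ∈ P, dist x y ≤ 1}

/-- The integers `k ≥ 0` such that for every `P ∈ 𝒫_n` some closed disc of radius `r` covers
at least `k` points of `P`. -/
def guaranteed (n : ℕ) (r : ℝ) : Set ℕ :=
  {k | ∀ P ∈ pointSets n, ∃ c : Plane, k ≤ ((P : Set Plane) ∩ Metric.closedBall c r).ncard}

/-- `N_n(r)`: the largest `k` such that for every `P ∈ 𝒫_n` some closed disc of radius `r` covers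
at least `k` points of `P`. -/
noncomputable def N (n : ℕ) (r : ℝ) : ℕ := sSup (guaranteed n r)

/-- The variant of `𝒫_n` in which points may coincide (several darts may land on one spot):
`n` labelled points, any two at distance at most `1`. -/
def pointFamilies (n : ℕ) : Set (Fin n → Plane) :=
  {p | ∀ i j, dist (p i) (p j) ≤ 1}

/-- The integers `k ≥ 0` such that for every family of `n` points, repetitions allowed, with
mutual distances at most `1`, some closed disc of radius `r` covers at least `k` of them, counted
with multiplicity. -/
def guaranteedMulti (n : ℕ) (r : ℝ) : Set ℕ :=
  {k | ∀ p ∈ pointFamilies n, ∃ c : Plane, k ≤ {i | p i ∈ Metric.closedBall c r}.ncard}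

/-- `N_n(r)` when points may coincide and are counted with multiplicity. -/
noncomputable def NMulti (n : ℕ) (r : ℝ) : ℕ := sSup (guaranteedMulti n r)

theorem pointSets_nonempty (n : ℕ) : (pointSets n).Nonempty := by
  classical
  let f : Fin n → Plane := fun i => EuclideanSpace.single 0 ((i : ℝ) / n)
  have hd : ∀ i j, dist (f i) (f j) = |(i : ℝ) / n - (j : ℝ) / n| := fun i j => by
    simp only [f, EuclideanSpace.dist_single_same, Real.dist_eq]
  have hinj : Function.Injective f := by
    intro i j h
    have hn : (n : ℝ) ≠ 0 := by
      have := i.pos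
      positivity
    have h0 := hd i j
    rw [h, dist_self, eq_comm, abs_eq_zero, sub_eq_zero, div_left_inj' hn] at h0
    exact Fin.ext (by exact_mod_cast h0)
  refine ⟨Finset.univ.image f, ?_, ?_⟩
  · rw [Finset.card_image_of_injective _ hinj, Finset.card_univ, Fintype.card_fin]
  · intro x hx y hy
    obtain ⟨i, -, rfl⟩ := Finset.mem_image.1 hx
    obtain ⟨j, -, rfl⟩ := Finset.mem_image.1 hy
    rw [hd]
    have key : ∀ k : Fin n, 0 ≤ (k : ℝ) / n ∧ (k : ℝ) / n ≤ 1 := fun k =>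
      ⟨by positivity, div_le_one_of_le₀ (by exact_mod_cast k.isLt.le) (by positivity)⟩
    rw [abs_le]
    constructor <;> linarith [key i, key j]

/-- The maximum that defines `N_n(r)` exists. -/
theorem isGreatest_N (n : ℕ) (r : ℝ) : IsGreatest (guaranteed n r) (N n r) := by
  have hb : BddAbove (guaranteed n r) := by
    refine ⟨n, fun k hk => ?_⟩
    obtain ⟨P, hP⟩ := pointSets_nonempty n
    obtain ⟨c, hc⟩ := hk P hP
    have := Set.ncard_le_ncard (Set.inter_subset_left (s := (P : Set Plane))
      (t := Metric.closedBall c r)) P.finite_toSet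
    rw [Set.ncard_coe_finset, hP.1] at this
    exact hc.trans this
  exact ⟨Nat.sSup_mem ⟨0, fun _ _ => ⟨0, Nat.zero_le _⟩⟩ hb, fun _ hk => le_csSup hb hk⟩

/-- The maximum that defines `NMulti n r` exists. -/
theorem isGreatest_NMulti (n : ℕ) (r : ℝ) :
    IsGreatest (guaranteedMulti n r) (NMulti n r) := by
  have hb : BddAbove (guaranteedMulti n r) := by
    refine ⟨n, fun k hk => ?_⟩
    obtain ⟨c, hc⟩ := hk (fun _ => 0) (fun _ _ => by simp)
    refine hc.trans ((Set.ncard_le_card _).trans ?_)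
    simp
  exact ⟨Nat.sSup_mem ⟨0, fun _ _ => ⟨0, Nat.zero_le _⟩⟩ hb, fun _ hk => le_csSup hb hk⟩

end DartBoard

-- Lower bound, with multiplicity: by Jung's theorem the points lie in a disc of radius `1 / √3`,
-- which three discs of radius `1 / 2` cover; pigeonhole gives one of these at least `n` points.
-- Distinct points are a special case of families, so `NMulti ≤ N`, and an upper bound for `N`
-- completes both chains.
--
-- Upper bound: nested clusters sit near the vertices of a unit equilateral triangle. One outer
-- point `q i` per vertex is added around a much smaller inner configuration. A disc of radius `1 /
-- 2` misses one cluster entirely. If it meets both other inner clusters, its centre is close to the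
-- midpoint of a side and it omits one of the two outer points there; otherwise it covers at most
-- one point of one cluster. Either way the bound grows by only one (`exists_clusters`).

namespace DartBoard

-- Jung's theorem in the plane

section Jung

variable {E ι : Type*} [NormedAddCommGroup E] [InnerProductSpace ℝ E]

/-- The variance of a weighted family of points. -/
noncomputable def weightedVariance [Fintype ι] (x : ι → E) (w : ι → ℝ) : ℝ :=
  ∑ i, w i * ‖x i‖ ^ 2 - ‖∑ i, w i • x i‖ ^ 2

theorem two_mul_weightedVariance [Fintype ι] (x : ι → E) {w : ι → ℝ} (hw : ∑ i, w i = 1) :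
    2 * weightedVariance x w = ∑ i, ∑ j, w i * w j * ‖x i - x j‖ ^ 2 := by
  have h1 : ‖∑ i, w i • x i‖ ^ 2 = ∑ i, ∑ j, w i * w j * inner ℝ (x i) (x j) := by
    rw [← real_inner_self_eq_norm_sq, sum_inner]
    refine Finset.sum_congr rfl fun i _ => ?_
    rw [inner_sum]
    refine Finset.sum_congr rfl fun j _ => ?_
    rw [real_inner_smul_left, real_inner_smul_right]
    ring
  have h2 : ∑ i, ∑ j, w i * w j * ‖x i‖ ^ 2 = ∑ i, w i * ‖x i‖ ^ 2 := by
    refine Finset.sum_congr rfl fun i _ => ?_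
    rw [← Finset.sum_mul, ← Finset.mul_sum, hw, mul_one]
  have h3 : ∑ i, ∑ j, w i * w j * ‖x j‖ ^ 2 = ∑ i, w i * ‖x i‖ ^ 2 := by
    rw [Finset.sum_comm]
    refine Finset.sum_congr rfl fun j _ => ?_
    rw [← Finset.sum_mul, ← Finset.sum_mul, hw, one_mul]
  have h4 : ∑ i, ∑ j, w i * w j * ‖x i - x j‖ ^ 2 =
      ∑ i, ∑ j, w i * w j * ‖x i‖ ^ 2 - 2 * ∑ i, ∑ j, w i * w j * inner ℝ (x i) (x j)
        + ∑ i, ∑ j, w i * w j * ‖x j‖ ^ 2 := by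
    simp only [Finset.mul_sum, ← Finset.sum_sub_distrib, ← Finset.sum_add_distrib]
    refine Finset.sum_congr rfl fun i _ => Finset.sum_congr rfl fun j _ => ?_
    rw [norm_sub_sq_real]
    ring
  rw [h4, h2, h3, ← h1, weightedVariance]
  ring

/-- In the pairwise form of the variance the diagonal vanishes, so twice it is at most `1 - ∑ w i ^
2`, and Cauchy–Schwarz gives `∑ w i ^ 2 ≥ 1 / 3`. -/
theorem weightedVariance_le_one_third [Fintype ι] (hι : Fintype.card ι ≤ 3) (x : ι → E)
    (hx : ∀ i j, ‖x i - x j‖ ≤ 1) {w : ι → ℝ} (hw : w ∈ stdSimplex ℝ ι) :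
    weightedVariance x w ≤ 1 / 3 := by
  classical
  have h1 : ∑ i, ∑ j, w i * w j * ‖x i - x j‖ ^ 2 ≤
      ∑ i, ∑ j, (w i * w j - if i = j then w i ^ 2 else 0) := by
    refine Finset.sum_le_sum fun i _ => Finset.sum_le_sum fun j _ => ?_
    split_ifs with h
    · subst h
      simp [sq]
    · rw [sub_zero]
      exact mul_le_of_le_one_right (mul_nonneg (hw.1 i) (hw.1 j))
        (pow_le_one₀ (norm_nonneg _) (hx i j))
  have h2 : ∑ i, ∑ j, (w i * w j - if i = j then w i ^ 2 else 0) = 1 - ∑ i, w i ^ 2 := by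
    simp [Finset.sum_sub_distrib, ← Finset.mul_sum, hw.2]
  have h3 : (1 : ℝ) ≤ 3 * ∑ i, w i ^ 2 := by
    have h := sq_sum_le_card_mul_sum_sq (s := Finset.univ) (f := w)
    rw [hw.2, one_pow, Finset.card_univ] at h
    refine h.trans ?_
    gcongr
    exact_mod_cast hι
  have := two_mul_weightedVariance x hw.2
  linarith

/-- **Jung's theorem** for at most three points. -/
theorem exists_norm_sub_sq_le_one_third_of_card_le_three [Fintype ι] (hι : Fintype.card ι ≤ 3)
    (x : ι → E) (hx : ∀ i j, ‖x i - x j‖ ≤ 1) : ∃ c, ∀ i, ‖x i - c‖ ^ 2 ≤ 1 / 3 := by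
  classical
  rcases isEmpty_or_nonempty ι with h | ⟨⟨i₀⟩⟩
  · exact ⟨0, fun i => h.elim i⟩
  have hne : (stdSimplex ℝ ι).Nonempty := ⟨_, single_mem_stdSimplex ℝ i₀⟩
  have hcont : Continuous (weightedVariance x) := by
    unfold weightedVariance
    fun_prop
  -- The centre is the barycentre for weights of maximal variance. Moving weight `t` to `x i`
  -- changes the variance `V` to `(1 - t) * V + t * (1 - t) * ‖x i - c‖ ^ 2`; maximality and `t → 0`
  -- give `‖x i - c‖ ^ 2 ≤ V`.
  obtain ⟨w, hw, hmax⟩ := (isCompact_stdSimplex ℝ ι).exists_isMaxOn hne hcont.continuousOn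
  have hV := weightedVariance_le_one_third hι x hx hw
  refine ⟨∑ i, w i • x i, fun i => ?_⟩
  set c := ∑ i, w i • x i with hc
  have key : ∀ t : ℝ, 0 < t → t < 1 → (1 - t) * ‖x i - c‖ ^ 2 ≤ 1 / 3 := by
    intro t ht0 ht1
    have hmem : (1 - t) • w + t • Pi.single i 1 ∈ stdSimplex ℝ ι :=
      convex_stdSimplex ℝ ι hw (single_mem_stdSimplex ℝ i) (by linarith) ht0.le (by ring)
    have hle : weightedVariance x ((1 - t) • w + t • Pi.single i 1) ≤ weightedVariance x w :=
      hmax hmem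
    have hS : ∑ j, ((1 - t) • w + t • (Pi.single i 1 : ι → ℝ)) j • x j = (1 - t) • c + t • x i := by
      simp [add_smul, Finset.sum_add_distrib, hc, Finset.smul_sum, mul_smul, Pi.single_apply]
    have hQ : ∑ j, ((1 - t) • w + t • (Pi.single i 1 : ι → ℝ)) j * ‖x j‖ ^ 2 =
        (1 - t) * ∑ j, w j * ‖x j‖ ^ 2 + t * ‖x i‖ ^ 2 := by
      simp [add_mul, Finset.sum_add_distrib, Finset.mul_sum, mul_assoc, Pi.single_apply]
    have hN : ‖(1 - t) • c + t • x i‖ ^ 2 =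
        (1 - t) * ‖c‖ ^ 2 + t * ‖x i‖ ^ 2 - t * (1 - t) * ‖x i - c‖ ^ 2 := by
      rw [norm_add_sq_real, norm_sub_sq_real, norm_smul, norm_smul, mul_pow, mul_pow,
        Real.norm_eq_abs, Real.norm_eq_abs, sq_abs, sq_abs, real_inner_smul_left,
        real_inner_smul_right, real_inner_comm c]
      ring
    have hVw : weightedVariance x w = ∑ j, w j * ‖x j‖ ^ 2 - ‖c‖ ^ 2 := rfl
    rw [weightedVariance, hS, hQ, hN] at hle
    refine le_of_mul_le_mul_left ?_ ht0
    nlinarith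
  have hlim : Filter.Tendsto (fun t : ℝ => (1 - t) * ‖x i - c‖ ^ 2) (nhdsWithin 0 (Set.Ioi 0))
      (nhds ((1 - 0) * ‖x i - c‖ ^ 2)) :=
    Filter.Tendsto.mono_left (Continuous.tendsto (by fun_prop) 0) nhdsWithin_le_nhds
  rw [sub_zero, one_mul] at hlim
  refine le_of_tendsto hlim ?_
  filter_upwards [Ioo_mem_nhdsGT (zero_lt_one (α := ℝ))] with t ht
  exact key t ht.1 ht.2

/-- **Jung's theorem** for finite families of points in the plane. -/
theorem exists_norm_sub_sq_le_one_third [Fintype ι] (hE : Module.finrank ℝ E = 2)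
    (x : ι → E) (hx : ∀ i j, ‖x i - x j‖ ≤ 1) : ∃ c, ∀ i, ‖x i - c‖ ^ 2 ≤ 1 / 3 := by
  have : FiniteDimensional ℝ E := Module.finite_of_finrank_pos (by omega)
  have hball : ∀ c y : E, c ∈ Metric.closedBall y √(1 / 3) ↔ ‖y - c‖ ^ 2 ≤ 1 / 3 := fun c y => by
    rw [Metric.mem_closedBall, dist_comm, dist_eq_norm, Real.le_sqrt (norm_nonneg _) (by norm_num)]
  -- A centre is a common point of the discs about the `x i`; by Helly in dimension two, three discs
  -- at a time suffice.
  obtain ⟨c, hc⟩ := Convex.helly_theorem' (𝕜 := ℝ) (s := Finset.univ)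
    (F := fun i => Metric.closedBall (x i) √(1 / 3)) (fun i _ => convex_closedBall _ _) (by
      intro I _ hI
      obtain ⟨c, hc⟩ := exists_norm_sub_sq_le_one_third_of_card_le_three (ι := I)
        (by rw [Fintype.card_coe]; omega) (fun i => x i) (fun i j => hx i j)
      exact ⟨c, Set.mem_iInter₂.2 fun i hi => (hball _ _).2 (hc ⟨i, hi⟩)⟩)
  exact ⟨c, fun i => (hball _ _).1 (Set.mem_iInter₂.1 hc i (Finset.mem_univ i))⟩

end Jung

-- Covering by three discs, and the lower bound

/-- Coordinate form of the covering of a disc of radius `1 / √3` by three discs of radius `1 / 2`. -/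
theorem sq_add_sq_le_one_fourth_of_le_one_third {s a b : ℝ} (hs0 : 0 < s) (hs2 : s ^ 2 = 3)
    (h : a ^ 2 + b ^ 2 ≤ 1 / 3) :
    (a - s / 6) ^ 2 + b ^ 2 ≤ 1 / 4 ∨ (a + s / 12) ^ 2 + (b - 1 / 4) ^ 2 ≤ 1 / 4 ∨
      (a + s / 12) ^ 2 + (b + 1 / 4) ^ 2 ≤ 1 / 4 := by
  by_contra! hcon
  obtain ⟨h0, h1, h2⟩ := hcon
  obtain ⟨r, hr0, hr⟩ : ∃ r : ℝ, 0 ≤ r ∧ r ^ 2 = a ^ 2 + b ^ 2 :=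
    ⟨√(a ^ 2 + b ^ 2), by positivity, Real.sq_sqrt (by positivity)⟩
  have hrs : r * s ≤ 1 := by
    have : (r * s) ^ 2 ≤ 1 := by rw [mul_pow, hs2]; linarith
    exact (sq_le_one_iff₀ (by positivity)).1 this
  have hq : r ^ 2 ≤ r * s / 6 + 1 / 6 := by
    have h0 : 0 ≤ r * s := by positivity
    have h1 : 0 ≤ (1 - r * s) * (1 + 2 * (r * s)) := mul_nonneg (by linarith) (by linarith)
    have e : (1 - r * s) * (1 + 2 * (r * s)) = 1 + r * s - 6 * r ^ 2 := by
      linear_combination -2 * r ^ 2 * hs2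
    linarith
  have lt_half : ∀ t, s * t < s * (r / 2) → t < r / 2 := fun t ht => lt_of_mul_lt_mul_left ht hs0.le
  -- The projections of `(a, b)` on the three centre directions, 120° apart, are all below `r / 2`.
  -- They sum to `0`, hence exceed `-r`, and their squares sum to `3 / 2 * r ^ 2`; so the three
  -- positive products below sum to zero.
  have t0 : a < r / 2 := lt_half _ (by linarith)
  have t1 : -a / 2 + s * b / 2 < r / 2 := lt_half _ (by linarith [congrArg (· * b) hs2])
  have t2 : -a / 2 - s * b / 2 < r / 2 := lt_half _ (by linarith [congrArg (· * b) hs2])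
  have p0 := mul_pos (sub_pos.2 t0) (by linarith : 0 < a + r)
  have p1 := mul_pos (sub_pos.2 t1) (by linarith : 0 < -a / 2 + s * b / 2 + r)
  have p2 := mul_pos (sub_pos.2 t2) (by linarith : 0 < -a / 2 - s * b / 2 + r)
  have : (r / 2 - a) * (a + r) + (r / 2 - (-a / 2 + s * b / 2)) * (-a / 2 + s * b / 2 + r)
      + (r / 2 - (-a / 2 - s * b / 2)) * (-a / 2 - s * b / 2 + r) = 0 := by
    linear_combination 3 / 2 * hr - b ^ 2 / 2 * hs2
  linarith

/-- A disc of radius `1 / √3` is covered by three discs of radius `1 / 2`. -/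
theorem exists_three_discs (c : Plane) : ∃ d : Fin 3 → Plane, ∀ x : Plane, ‖x - c‖ ^ 2 ≤ 1 / 3 →
    ∃ k, x ∈ Metric.closedBall (d k) (1 / 2) := by
  have hsq : ∀ x y : Plane, ‖x - y‖ ^ 2 = (x 0 - y 0) ^ 2 + (x 1 - y 1) ^ 2 := fun x y => by
    rw [EuclideanSpace.norm_sq_eq, Fin.sum_univ_two]
    simp
  have hmem : ∀ x d : Plane, (x 0 - d 0) ^ 2 + (x 1 - d 1) ^ 2 ≤ 1 / 4 →
      x ∈ Metric.closedBall d (1 / 2) := fun x d h => by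
    rw [Metric.mem_closedBall, dist_eq_norm]
    refine abs_le_of_sq_le_sq' ?_ (by norm_num) |>.2
    rw [hsq]
    linarith
  have hs2 : √3 ^ 2 = (3 : ℝ) := Real.sq_sqrt (by norm_num)
  -- The centres are the side midpoints of an equilateral triangle inscribed in the large disc.
  refine ⟨![c + !₂[√3 / 6, 0], c + !₂[-√3 / 12, 1 / 4], c + !₂[-√3 / 12, -1 / 4]],
    fun x hx => ?_⟩
  rw [hsq] at hx
  rcases sq_add_sq_le_one_fourth_of_le_one_third (by positivity) hs2 hx with h | h | h
  · refine ⟨0, hmem _ _ (le_of_eq_of_le ?_ h)⟩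
    simp
    ring
  · refine ⟨1, hmem _ _ (le_of_eq_of_le ?_ h)⟩
    simp
    ring
  · refine ⟨2, hmem _ _ (le_of_eq_of_le ?_ h)⟩
    simp
    ring

theorem le_NMulti (n : ℕ) : n ≤ NMulti (3 * n) (1 / 2) := by
  refine (isGreatest_NMulti _ _).2 fun p hp => ?_
  obtain ⟨c, hc⟩ := exists_norm_sub_sq_le_one_third (E := Plane) (by simp) p
    (fun i j => by simpa [dist_eq_norm] using hp i j)
  obtain ⟨d, hd⟩ := exists_three_discs c
  choose k hk using fun i => hd (p i) (hc i)
  obtain ⟨y, hy⟩ := Fintype.exists_le_card_fiber_of_mul_le_card k (n := n) (by simp)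
  refine ⟨d y, hy.trans ?_⟩
  rw [← Set.ncard_coe_finset]
  refine Set.ncard_le_ncard (fun i hi => ?_) (Set.toFinite _)
  obtain rfl : k i = y := by simpa using hi
  exact hk i

theorem guaranteedMulti_subset_guaranteed (n : ℕ) (r : ℝ) :
    guaranteedMulti n r ⊆ guaranteed n r := by
  intro k hk P hP
  let e : Fin n ≃ P := (P.equivFinOfCardEq hP.1).symm
  obtain ⟨c, hc⟩ := hk (fun i => e i) (fun i j => hP.2 _ (e i).2 _ (e j).2)
  refine ⟨c, hc.trans ?_⟩
  refine Set.ncard_le_ncard_of_injOn (fun i => (e i : Plane)) (fun i hi => ⟨(e i).2, hi⟩)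
    (fun i _ j _ h => e.injective (Subtype.ext h)) (P.finite_toSet.inter_of_left _)

theorem NMulti_le_N (n : ℕ) (r : ℝ) : NMulti n r ≤ N n r :=
  (isGreatest_N n r).2 (guaranteedMulti_subset_guaranteed n r (isGreatest_NMulti n r).1)

-- Clusters at the vertices of a triangle, and the upper bound

/-- The vertices of an equilateral triangle of side `1`. -/
noncomputable def vertex : Fin 3 → Plane := ![!₂[0, 0], !₂[1, 0], !₂[1 / 2, √3 / 2]]

theorem dist_sq_eq (x y : Plane) : dist x y ^ 2 = (x 0 - y 0) ^ 2 + (x 1 - y 1) ^ 2 := by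
  rw [dist_eq_norm, EuclideanSpace.norm_sq_eq, Fin.sum_univ_two]
  simp

theorem dist_vertex {i j : Fin 3} (h : i ≠ j) : dist (vertex i) (vertex j) = 1 := by
  have h3 : √3 ^ 2 = (3 : ℝ) := Real.sq_sqrt (by norm_num)
  refine (sq_eq_sq₀ dist_nonneg zero_le_one).1 ?_
  rw [dist_sq_eq]
  fin_cases i <;> fin_cases j <;> simp [vertex] at h ⊢ <;> linarith

theorem dist_midpoint_sq {E : Type*} [NormedAddCommGroup E] [InnerProductSpace ℝ E] (a b c : E) :
    dist c (midpoint ℝ a b) ^ 2 = (dist a c ^ 2 + dist b c ^ 2) / 2 - dist a b ^ 2 / 4 := by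
  have h : c - midpoint ℝ a b = (1 / 2 : ℝ) • ((c - a) + (c - b)) := by
    rw [midpoint_eq_smul_add]
    match_scalars <;> norm_num
  have h' : ‖a - b‖ ^ 2 = ‖c - a‖ ^ 2 - 2 * inner ℝ (c - a) (c - b) + ‖c - b‖ ^ 2 := by
    rw [← norm_sub_sq_real, ← norm_neg (a - b)]
    congr 2
    abel
  rw [dist_comm a c, dist_comm b c, dist_eq_norm, dist_eq_norm, dist_eq_norm, dist_eq_norm, h, h',
    norm_smul, mul_pow, norm_add_sq_real]
  norm_num
  ring

/-- Points which can be added to three small clusters at the vertices. -/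
structure IsOuter (q : Fin 3 → Plane) : Prop where
  ne_vertex : ∀ i, q i ≠ vertex i
  dist_vertex_lt : ∀ i j, i ≠ j → dist (q i) (vertex j) < 1
  dist_lt : ∀ i j, i ≠ j → dist (q i) (q j) < 1
  lt_dist_midpoint : ∀ i, 1 / 2 < dist (q i) (midpoint ℝ (vertex i) (vertex (i + 1)))

theorem dist_lt_of_sq_lt {x y : Plane} {r : ℝ} (hr : 0 ≤ r) (h : dist x y ^ 2 < r ^ 2) :
    dist x y < r := lt_of_pow_lt_pow_left₀ 2 hr h

theorem exists_isOuter {ε : ℝ} (hε : 0 < ε) :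
    ∃ q, IsOuter q ∧ ∀ i, dist (q i) (vertex i) < ε := by
  obtain ⟨t, ht0, htε, ht⟩ : ∃ t : ℝ, 0 < t ∧ 4 * t ≤ ε ∧ t ≤ 1 / 4 :=
    ⟨min (ε / 4) (1 / 4), by positivity, by linarith [min_le_left (ε / 4) (1 / 4)],
      min_le_right _ _⟩
  set s : ℝ := √3 with hs
  have hs2 : s ^ 2 = 3 := Real.sq_sqrt (by norm_num)
  have hs0 : 0 < s := by positivity
  -- Shift by `√3 * t` perpendicular to the side towards the third vertex, and by `κ * t ^ 2` along
  -- the side. To leading order, distance below `1` to `vertex (i + 1)` needs `κ > 3 / 2`, and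
  -- distance above `1 / 2` to the midpoint needs `κ < 3`; here `κ = 2`.
  let q : Fin 3 → Plane := fun i => vertex i + (2 * t ^ 2) • (vertex (i + 1) - vertex i) +
    t • ((2 : ℝ) • (vertex (i + 2) - vertex i) - (vertex (i + 1) - vertex i))
  have hq_self : ∀ i, dist (q i) (vertex i) ^ 2 = 3 * t ^ 2 + 4 * t ^ 4 := by
    intro i
    rw [dist_sq_eq]
    fin_cases i <;> simp [q, vertex] <;> ring_nf <;> simp only [← hs, hs2] <;> ring
  have hq_one : ∀ i, dist (q i) (vertex (i + 1)) ^ 2 = 1 - t ^ 2 + 4 * t ^ 4 := by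
    intro i
    rw [dist_sq_eq]
    fin_cases i <;> simp [q, vertex] <;> ring_nf <;> simp only [← hs, hs2] <;> ring
  have hq_two : ∀ i, dist (q i) (vertex (i + 2)) ^ 2 = 1 - 3 * t + t ^ 2 + 4 * t ^ 4 := by
    intro i
    rw [dist_sq_eq]
    fin_cases i <;> simp [q, vertex] <;> ring_nf <;> simp only [← hs, hs2] <;> ring
  have hq_q : ∀ i, dist (q i) (q (i + 1)) ^ 2 = 1 - 3 * t + 3 * t ^ 2 + 12 * t ^ 4 := by
    intro i
    rw [dist_sq_eq]
    fin_cases i <;> simp [q, vertex] <;> ring_nf <;> simp only [← hs, hs2] <;> ring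
  have ht2 : t ^ 2 ≤ t / 4 := by nlinarith
  have ht4 : 4 * t ^ 4 ≤ t ^ 2 / 4 := by nlinarith [sq_nonneg t]
  have htp : 0 < t ^ 2 := by positivity
  have hone : ∀ i, dist (q i) (vertex (i + 1)) < 1 := fun i =>
    dist_lt_of_sq_lt zero_le_one (by rw [hq_one]; linarith)
  have htwo : ∀ i, dist (q i) (vertex (i + 2)) < 1 := fun i =>
    dist_lt_of_sq_lt zero_le_one (by rw [hq_two]; linarith)
  have hqq : ∀ i, dist (q i) (q (i + 1)) < 1 := fun i =>
    dist_lt_of_sq_lt zero_le_one (by rw [hq_q]; linarith)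
  have hcases : ∀ i j : Fin 3, i ≠ j → j = i + 1 ∨ j = i + 2 ∧ i = j + 1 := by decide
  refine ⟨q, ⟨fun i h => ?_, fun i j hij => ?_, fun i j hij => ?_, fun i => ?_⟩, fun i => ?_⟩
  · have := hq_self i
    rw [h, dist_self] at this
    linarith [show 0 ≤ t ^ 4 by positivity]
  · rcases hcases i j hij with rfl | ⟨rfl, -⟩
    exacts [hone i, htwo i]
  · rcases hcases i j hij with h | ⟨-, h⟩
    · exact h ▸ hqq i
    · exact dist_comm (q i) (q j) ▸ h ▸ hqq j
  · refine lt_of_pow_lt_pow_left₀ 2 dist_nonneg ?_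
    rw [dist_midpoint_sq, dist_comm _ (q i), dist_comm _ (q i), hq_self, hq_one,
      dist_vertex (by simp)]
    linarith [show 0 ≤ t ^ 4 by positivity]
  · refine dist_lt_of_sq_lt hε.le ?_
    rw [hq_self]
    nlinarith

/-- The condition under which an inner configuration of size `δ` can be extended. -/
theorem IsOuter.eventually_half_lt_dist {q : Fin 3 → Plane} (hq : IsOuter q) (i : Fin 3) :
    ∀ᶠ δ in nhdsWithin (0 : ℝ) (Set.Ioi 0), ∀ a b c : Plane, dist a (vertex i) < δ →
      dist b (vertex (i + 1)) < δ → dist a c ≤ 1 / 2 → dist b c ≤ 1 / 2 →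
      1 / 2 < dist (q i) c := by
  set η : ℝ := dist (q i) (midpoint ℝ (vertex i) (vertex (i + 1))) - 1 / 2 with hη
  have hη0 : 0 < η := sub_pos.2 (hq.lt_dist_midpoint i)
  have hlim : Filter.Tendsto (fun δ : ℝ => δ + δ ^ 2) (nhdsWithin 0 (Set.Ioi 0))
      (nhds (0 + 0 ^ 2)) :=
    Filter.Tendsto.mono_left (Continuous.tendsto (by fun_prop) 0) nhdsWithin_le_nhds
  -- Since `c` is within `1 / 2 + δ` of both vertices, its squared distance to the midpoint is at
  -- most `(1 / 2 + δ) ^ 2 - 1 / 4 = δ + δ ^ 2`.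
  filter_upwards [hlim.eventually_lt_const (u := η ^ 2) (by simpa using by positivity)]
    with δ hδ a b c ha hb hac hbc
  have hA : dist (vertex i) c ^ 2 ≤ (1 / 2 + δ) ^ 2 := by
    refine pow_le_pow_left₀ dist_nonneg ?_ 2
    linarith [dist_triangle_left (vertex i) c a]
  have hB : dist (vertex (i + 1)) c ^ 2 ≤ (1 / 2 + δ) ^ 2 := by
    refine pow_le_pow_left₀ dist_nonneg ?_ 2
    linarith [dist_triangle_left (vertex (i + 1)) c b]
  have hm : dist c (midpoint ℝ (vertex i) (vertex (i + 1))) < η := by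
    refine dist_lt_of_sq_lt hη0.le ?_
    rw [dist_midpoint_sq, dist_vertex (by simp)]
    linarith
  linarith [dist_triangle (q i) c (midpoint ℝ (vertex i) (vertex (i + 1)))]

/-- A disc of radius `1 / 2` stays away from one of the vertices. -/
theorem exists_half_lt_dist_of_near_vertex (c : Plane) :
    ∃ i, ∀ x, dist x (vertex i) ≤ 1 / 20 → 1 / 2 < dist x c := by
  have h3 : √3 ^ 2 = (3 : ℝ) := Real.sq_sqrt (by norm_num)
  by_contra! hcon
  have hle : ∀ i, dist (vertex i) c ^ 2 ≤ (11 / 20) ^ 2 := fun i => by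
    obtain ⟨x, hx, hxc⟩ := hcon i
    refine pow_le_pow_left₀ dist_nonneg ?_ 2
    linarith [dist_triangle_left (vertex i) c x]
  have h0 := hle 0
  have h1 := hle 1
  have h2 := hle 2
  rw [dist_sq_eq] at h0 h1 h2
  simp only [vertex, Matrix.cons_val] at h0 h1 h2
  -- The squared distances from `c` to the vertices sum to at least `1`, attained at the centroid,
  -- while `3 * (11 / 20) ^ 2 < 1`.
  nlinarith [sq_nonneg (c 0 - 1 / 2), sq_nonneg (c 1 - √3 / 6)]

/-- Clusters of `n` points near the vertices of an equilateral triangle of side `1`, such that no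
disc of radius `1 / 2` covers more than `n + 1` points. -/
theorem exists_clusters (n : ℕ) : ∀ ε : ℝ, 0 < ε → ∃ S : Fin 3 → Finset Plane,
    (∀ i, (S i).card = n) ∧ (∀ i, ∀ x ∈ S i, dist x (vertex i) < ε) ∧
    (∀ i j, ∀ x ∈ S i, ∀ y ∈ S j, dist x y ≤ 1) ∧
    ∀ c : Plane, ∑ i, {x ∈ S i | dist x c ≤ 1 / 2}.card ≤ n + 1 := by
  classical
  induction n with
  | zero => exact fun ε _ => ⟨fun _ => ∅, by simp⟩
  | succ n ih =>
    intro ε hε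
    -- The outer points come first; the inner size `δ` is then chosen small in terms of them, which
    -- is why the induction carries every `ε`.
    obtain ⟨q, hq, hqε⟩ := exists_isOuter (lt_min hε (by norm_num : (0 : ℝ) < 1 / 20))
    have hev : ∀ᶠ δ in nhdsWithin (0 : ℝ) (Set.Ioi 0), 0 < δ ∧ δ < min ε (1 / 20) ∧
        (∀ i, δ < dist (q i) (vertex i)) ∧
        (∀ i j, i ≠ j → δ < 1 - dist (q i) (vertex j)) ∧
        ∀ i, ∀ a b c : Plane, dist a (vertex i) < δ → dist b (vertex (i + 1)) < δ →
          dist a c ≤ 1 / 2 → dist b c ≤ 1 / 2 → 1 / 2 < dist (q i) c := by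
      have small : ∀ r : ℝ, 0 < r → ∀ᶠ δ in nhdsWithin (0 : ℝ) (Set.Ioi 0), δ < r :=
        fun r hr => nhdsWithin_le_nhds (gt_mem_nhds hr)
      refine Filter.Eventually.and self_mem_nhdsWithin ((small _ (by positivity)).and (.and ?_ (.and ?_ ?_)))
      · exact Filter.eventually_all.2 fun i => small _ (dist_pos.2 (hq.ne_vertex i))
      · refine Filter.eventually_all.2 fun i => Filter.eventually_all.2 fun j => ?_
        by_cases hij : i = j
        · exact Filter.Eventually.of_forall fun _ h => absurd hij h
        · exact (small _ (sub_pos.2 (hq.dist_vertex_lt i j hij))).mono fun _ h _ => h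
      · exact Filter.eventually_all.2 fun i => hq.eventually_half_lt_dist i
    obtain ⟨δ, hδ0, hδε, hδself, hδone, hδq⟩ := hev.exists
    obtain ⟨S, hcard, hnear, hdist, hdisc⟩ := ih δ hδ0
    have hnotMem : ∀ i, q i ∉ S i := fun i h => (hδself i).not_gt (hnear i _ h)
    have hcard' : ∀ i, (insert (q i) (S i)).card = n + 1 := fun i => by
      rw [Finset.card_insert_of_notMem (hnotMem i), hcard]
    have hnear' : ∀ i, ∀ x ∈ insert (q i) (S i), dist x (vertex i) < min ε (1 / 20) := by
      intro i x hx
      rcases Finset.mem_insert.1 hx with rfl | hx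
      · exact hqε i
      · exact (hnear i x hx).trans hδε
    have hqS : ∀ i j, ∀ y ∈ S j, dist (q i) y ≤ 1 := by
      intro i j y hy
      have h1 := hnear j y hy
      have h2 := dist_triangle_right (q i) y (vertex j)
      by_cases hij : i = j
      · subst hij
        linarith [hqε i, min_le_right ε (1 / 20)]
      · linarith [hδone i j hij]
    refine ⟨fun i => insert (q i) (S i), hcard', fun i x hx =>
      (hnear' i x hx).trans_le (min_le_left _ _), fun i j x hx y hy => ?_, fun c => ?_⟩
    · rcases Finset.mem_insert.1 hx with rfl | hx <;> rcases Finset.mem_insert.1 hy with rfl | hy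
      · by_cases hij : i = j
        · simp [hij]
        · exact (hq.dist_lt i j hij).le
      · exact hqS i j y hy
      · exact dist_comm x (q j) ▸ hqS j i x hx
      · exact hdist i j x hx y hy
    · obtain ⟨k, hk⟩ := exists_half_lt_dist_of_near_vertex c
      have hsum : ∀ F : Fin 3 → ℕ, ∑ i, F i = F k + F (k + 1) + F (k + 1 + 1) := by
        intro F
        rw [Fin.sum_univ_three]
        fin_cases k <;> simp <;> ring
      have hdisc := hdisc c
      rw [hsum] at hdisc ⊢
      beta_reduce
      generalize k + 1 = i at hdisc ⊢
      have hzero : {x ∈ insert (q k) (S k) | dist x c ≤ 1 / 2}.card = 0 := by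
        rw [Finset.card_eq_zero, Finset.filter_eq_empty_iff]
        exact fun x hx =>
          (hk x ((hnear' k x hx).le.trans (min_le_right _ _))).not_ge
      have hle : ∀ j, {x ∈ insert (q j) (S j) | dist x c ≤ 1 / 2}.card ≤ n + 1 := fun j =>
        (Finset.card_filter_le _ _).trans (hcard' j).le
      have hle_add : ∀ j, {x ∈ insert (q j) (S j) | dist x c ≤ 1 / 2}.card ≤
          {x ∈ S j | dist x c ≤ 1 / 2}.card + 1 := fun j => by
        rw [Finset.filter_insert]
        split_ifs
        · exact Finset.card_insert_le _ _
        · exact Nat.le_succ _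
      have hi := hle i
      have hj := hle (i + 1)
      have hi' := hle_add i
      have hj' := hle_add (i + 1)
      -- If an inner cluster is missed, the count is at most `1 + (n + 1)`. If both are met, `q i`
      -- is lost, and only `q (i + 1)` can add to the inductive `n + 1`.
      rcases Finset.eq_empty_or_nonempty {x ∈ S i | dist x c ≤ 1 / 2} with h | ⟨a, ha⟩
      · rw [h, Finset.card_empty] at hi'
        omega
      rcases Finset.eq_empty_or_nonempty {x ∈ S (i + 1) | dist x c ≤ 1 / 2} with h | ⟨b, hb⟩
      · rw [h, Finset.card_empty] at hj'
        omega
      rw [Finset.mem_filter] at ha hb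
      have hlt := hδq i a b c (hnear _ _ ha.1) (hnear _ _ hb.1) ha.2 hb.2
      have heq : {x ∈ insert (q i) (S i) | dist x c ≤ 1 / 2} = {x ∈ S i | dist x c ≤ 1 / 2} := by
        rw [Finset.filter_insert, if_neg hlt.not_ge]
      rw [heq]
      omega

theorem N_le (n : ℕ) : N (3 * n) (1 / 2) ≤ n + 1 := by
  classical
  -- Radius `1 / 2` keeps the clusters disjoint, the vertices being at distance `1`.
  obtain ⟨S, hcard, hnear, hdist, hdisc⟩ := exists_clusters n (1 / 2) (by norm_num)
  have hdisj : ∀ i j, i ≠ j → Disjoint (S i) (S j) := fun i j hij => by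
    refine Finset.disjoint_left.2 fun x hi hj => ?_
    linarith [dist_triangle_left (vertex i) (vertex j) x, dist_vertex hij, hnear i x hi,
      hnear j x hj]
  obtain ⟨c, hc⟩ := (isGreatest_N (3 * n) (1 / 2)).1 (Finset.univ.biUnion S) (by
    refine ⟨?_, fun x hx y hy => ?_⟩
    · rw [Finset.card_biUnion fun i _ j _ hij => hdisj i j hij]
      simp [hcard]
    · obtain ⟨i, -, hx⟩ := Finset.mem_biUnion.1 hx
      obtain ⟨j, -, hy⟩ := Finset.mem_biUnion.1 hy
      exact hdist i j x hx y hy)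
  have hcover : ((Finset.univ.biUnion S : Finset Plane) : Set Plane) ∩ Metric.closedBall c (1 / 2) =
      (Finset.univ.biUnion fun i => {x ∈ S i | dist x c ≤ 1 / 2} : Finset Plane) := by
    ext x
    simp
  rw [hcover, Set.ncard_coe_finset] at hc
  exact hc.trans (Finset.card_biUnion_le.trans (hdisc c))

end DartBoard

theorem theorem3 (n : ℕ) (hn : 0 < n) :
    (n ≤ DartBoard.N (3 * n) (1 / 2) ∧ DartBoard.N (3 * n) (1 / 2) ≤ n + 1) ∧
    (n ≤ DartBoard.NMulti (3 * n) (1 / 2) ∧ DartBoard.NMulti (3 * n) (1 / 2) ≤ n + 1) := by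
  have h1 := DartBoard.le_NMulti n
  have h2 := DartBoard.NMulti_le_N (3 * n) (1 / 2)
  have h3 := DartBoard.N_le n
  exact ⟨⟨h1.trans h2, h3⟩, h1, h2.trans h3⟩
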